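/- Let $\mathcal H$ be a real Hilbert space and let $C_1,C_2\subseteq\mathcal H$ be nonempty closed convex sets. For a nonempty closed convex set $C$ let $P_C$ be the nearest point projection onto $C$ and $R_C:=2P_C-I$ the reflection. For nonempty closed convex sets $A,B$ let $T_{A,B}:=\tfrac12(I+R_BR_A)$ be the Douglas–Rachford operator and $T_{[A,B]}:=T_{B,A}T_{A,B}$ (so $T_{A,B}$ is applied first), and write $\operatorname{Fix}T:=\{x:Tx=x\}$. For an arbitrary $z\in\mathcal H$ define, for $n=0,1,2,\dots$, $$x_0^1:=z,\qquad x_n^2:=T_{C_1,C_2}x_n^1,\qquad x_{n+1}^1:=T_{C_2,C_1}x_n^2 .$$ Put $d(C_1,C_2):=\inf_{c_1\in C_1,\,c_2\in C_2}\|c_1-c_2\|$ and $$E:=\{e\in C_1:d(e,C_2)=d(C_1,C_2)\},\qquad F:=\{f\in C_2:d(f,C_1)=d(C_1,C_2)\},\qquad v:=P_{\overline{C_2-C_1}}(0).$$ Below, $\rightharpoonup$ denotes weak convergence and $\to$ norm convergence, as $n\to\infty$. Then the following hold. **(a)** For every $n$ the stated equalities hold, and $$P_{C_2}R_{C_1}x_n^1-P_{C_2}x_n^2=(x_n^2-x_n^1)-(P_{C_2}x_n^2-P_{C_1}x_n^1)\to0,$$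 $$P_{C_1}R_{C_2}x_n^2-P_{C_1}x_{n+1}^1=(x_{n+1}^1-x_n^2)-(P_{C_1}x_{n+1}^1-P_{C_2}x_n^2)\to0.$$ **(b)** Exactly one of the following alternatives holds. (i) $E$, $F$, $\operatorname{Fix}T_{[C_1,C_2]}$ and $\operatorname{Fix}T_{[C_2,C_1]}$ are all empty. In this case $\|x_n^1\|\to+\infty$ and $\|x_n^2\|\to+\infty$. (ii) $E$, $F$, $\operatorname{Fix}T_{[C_1,C_2]}$ and $\operatorname{Fix}T_{[C_2,C_1]}$ are all nonempty. In this case $$x_n^2-x_n^1=P_{C_2}R_{C_1}x_n^1-P_{C_1}x_n^1\to v,\qquad P_{C_2}x_n^2-P_{C_1}x_n^1\to v,$$ $$x_{n+1}^1-x_n^2=P_{C_1}R_{C_2}x_n^2-P_{C_2}x_n^2\to-v,\qquad P_{C_1}x_{n+1}^1-P_{C_2}x_n^2\to-v,$$ and there are points $x^1\in\operatorname{Fix}T_{[C_1,C_2]}$ and $x^2\in\operatorname{Fix}T_{[C_2,C_1]}$ with $$x_n^1\rightharpoonup x^1,\qquad x_n^2\rightharpoonup x^2,\qquad x^2=T_{C_1,C_2}x^1,\qquad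 x^1=T_{C_2,C_1}x^2,$$ $$x^2-x^1=P_{C_2}x^2-P_{C_1}x^1=v,\qquad P_{C_1}R_{C_2}x^2=P_{C_1}x^1\in E,\qquad P_{C_2}R_{C_1}x^1=P_{C_2}x^2\in F.$$ In particular $(P_{C_1}x^1,P_{C_2}x^2)$ is a best approximation pair: it attains the infimum of $\|c_1-c_2\|$ over $(c_1,c_2)\in C_1\times C_2$. -/

import Mathlib

open Filter Topology
open scoped Pointwise

noncomputable section

namespace DouglasRachford

variable {H : Type*} [NormedAddCommGroup H]

/-- `c` is a nearest point of `C` to `x`. -/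
def IsNearest (C : Set H) (x c : H) : Prop :=
  c ∈ C ∧ ∀ c' ∈ C, ‖c - x‖ ≤ ‖c' - x‖

open Classical in
/-- The nearest point projection `P_C x = argmin_{c ∈ C} ‖c - x‖`. For `C` nonempty, closed and
convex in a Hilbert space the nearest point exists and is unique (see `proj_eq_iff` below); the
value `0` is used only if there is no nearest point. -/
def proj (C : Set H) (x : H) : H :=
  if h : ∃ c, IsNearest C x c then h.choose else 0

section Hilbert

variable [InnerProductSpace ℝ H]

/-- In a Hilbert space, `proj C x` is the unique nearest point for nonempty closed convex `C`. -/
theorem proj_eq_iff [CompleteSpace H] {C : Set H} (hne : C.Nonempty) (hcl : IsClosed C)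
    (hconv : Convex ℝ C) (x c : H) : proj C x = c ↔ IsNearest C x c := by
  have key : ∀ c, IsNearest C x c ↔ c ∈ C ∧ ‖x - c‖ = ⨅ w : C, ‖x - w‖ := by
    intro c
    have hbdd : BddBelow (Set.range fun w : C => ‖x - w‖) :=
      ⟨0, by rintro _ ⟨w, rfl⟩; exact norm_nonneg _⟩
    have : Nonempty C := hne.to_subtype
    constructor
    · rintro ⟨hc, hmin⟩
      refine ⟨hc, le_antisymm (le_ciInf fun w => ?_) (ciInf_le hbdd ⟨c, hc⟩)⟩
      rw [norm_sub_rev x c, norm_sub_rev x w]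
      exact hmin w w.2
    · rintro ⟨hc, heq⟩
      refine ⟨hc, fun w hw => ?_⟩
      rw [norm_sub_rev c x, norm_sub_rev w x, heq]
      exact ciInf_le hbdd ⟨w, hw⟩
  have uniq : ∀ a b, IsNearest C x a → IsNearest C x b → a = b := by
    intro a b ha hb
    obtain ⟨ha, ha'⟩ := (key a).1 ha
    obtain ⟨hb, hb'⟩ := (key b).1 hb
    have h1 := (norm_eq_iInf_iff_real_inner_le_zero hconv ha).1 ha' b hb
    have h2 := (norm_eq_iInf_iff_real_inner_le_zero hconv hb).1 hb' a ha
    have h3 : inner ℝ (a - b) (a - b) ≤ 0 := by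
      have e : inner ℝ (a - b) (a - b) = inner ℝ (x - a) (b - a) + inner ℝ (x - b) (a - b) := by
        simp only [inner_sub_left, inner_sub_right]
        ring
      linarith
    exact sub_eq_zero.1 (real_inner_self_nonpos.1 h3)
  have hex : ∃ c, IsNearest C x c := by
    obtain ⟨c, hc, hc'⟩ := exists_norm_eq_iInf_of_complete_convex hne hcl.isComplete hconv x
    exact ⟨c, (key c).2 ⟨hc, hc'⟩⟩
  have hspec : IsNearest C x (proj C x) := by
    unfold proj
    rw [dif_pos hex]
    exact hex.choose_spec
  exact ⟨fun h => h ▸ hspec, fun h => uniq _ _ hspec h⟩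

/-- The reflection `R_C = 2 P_C - I`. -/
def reflect (C : Set H) (x : H) : H := (2 : ℝ) • proj C x - x

/-- The Douglas–Rachford operator `T_{A,B} = (I + R_B R_A) / 2`. -/
def drOp (A B : Set H) (x : H) : H := (1 / 2 : ℝ) • (x + reflect B (reflect A x))

/-- The two-set cyclic Douglas–Rachford operator `T_{[A,B]} = T_{B,A} T_{A,B}`
(the operator `T_{A,B}` is applied first). -/
def cyclicOp (A B : Set H) : H → H := drOp B A ∘ drOp A B

/-- The first cyclic Douglas–Rachford sequence: it starts at `z`, and each term is obtained from
the previous one by applying `T_{A,B}` and then `T_{B,A}`. (Numbered from `0`.) -/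
def seq₁ (A B : Set H) (z : H) : ℕ → H
  | 0 => z
  | n + 1 => drOp B A (drOp A B (seq₁ A B z n))

/-- The second cyclic Douglas–Rachford sequence, `x²ₙ = T_{A,B} x¹ₙ`. -/
def seq₂ (A B : Set H) (z : H) (n : ℕ) : H := drOp A B (seq₁ A B z n)

/-- Weak convergence of a sequence, i.e. convergence in the weak topology of `H`. -/
def WeakConv (x : ℕ → H) (l : H) : Prop :=
  Tendsto (fun n => toWeakSpace ℝ H (x n)) atTop (𝓝 (toWeakSpace ℝ H l))

end Hilbert

/-- The distance between two sets, `d(A,B) = inf_{a ∈ A, b ∈ B} ‖a - b‖`. -/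
def setDist (A B : Set H) : ℝ := ⨅ p : A × B, ‖(p.1 : H) - (p.2 : H)‖

/-- The points of `A` at minimal distance from `B`: `{a ∈ A | d(a,B) = d(A,B)}`. The set `E` is
`nearestSet C₁ C₂` and the set `F` is `nearestSet C₂ C₁`. -/
def nearestSet (A B : Set H) : Set H := {a | a ∈ A ∧ Metric.infDist a B = setDist A B}

/-- The displacement vector: the projection of `0` onto the closure of `B - A`. -/
def displacement (A B : Set H) : H := proj (closure (B - A)) 0

/-- `(a, b)` is a best approximation pair with respect to `(A, B)`: it attains the infimum
of `‖a - b‖` over `A × B`. -/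
def IsBestApproxPair (A B : Set H) (a b : H) : Prop :=
  a ∈ A ∧ b ∈ B ∧ ∀ a' ∈ A, ∀ b' ∈ B, ‖a - b‖ ≤ ‖a' - b'‖

end DouglasRachford

end

open DouglasRachford

/-! Two monotone quantities drive the proof. The identity `T x - P_B (R_A x) = x - P_A x`, with `T =
T_{A,B}`, shows that the distance of the iterate to its current set never increases, and that its
square drops by at least `‖P_B (R_A x) - P_B (T x)‖ ^ 2` at each half-step. Telescoping gives (a).
In a cycle no drop is possible, so at a fixed point these projections coincide, and the normal-cone
inequalities make the shadows a best approximation pair. Conversely such a pair is swapped by the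
two operators. Hence all four sets are nonempty exactly when a best approximation pair exists.

The other quantity is the distance between two orbits. The cyclic operator is averaged and has
almost fixed points, so it is asymptotically regular even without fixed points. Demiclosedness then
forces norms to infinity when there is no fixed point, and Opial's argument gives weak convergence
otherwise. Firm nonexpansiveness, applied against a best approximation pair, makes the half-steps
converge in norm to `v` and `-v`. -/

namespace DouglasRachford

variable {H : Type*} [NormedAddCommGroup H] [InnerProductSpace ℝ H]

/-- Nonempty closed convex sets. -/
structure ClosedConvex (C : Set H) : Prop where
  nonempty : C.Nonempty
  isClosed : IsClosed C
  convex : Convex ℝ C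

theorem norm_sub_le_of_inner_nonpos {x c c' : H} (h : inner ℝ (x - c) (c' - c) ≤ 0) :
    ‖x - c‖ ^ 2 + ‖c - c'‖ ^ 2 ≤ ‖x - c'‖ ^ 2 := by
  have e : x - c' = (x - c) - (c' - c) := by abel
  rw [e, norm_sub_sq_real (x - c) (c' - c), norm_sub_rev c c']
  linarith

/-! ### Obtuse-angle characterization of projections; reflections -/

section Projection

variable [CompleteSpace H] {C : Set H}

theorem ClosedConvex.isNearest_proj (hC : ClosedConvex C) (x : H) : IsNearest C x (proj C x) :=
  (proj_eq_iff hC.nonempty hC.isClosed hC.convex x _).1 rfl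

theorem ClosedConvex.proj_mem (hC : ClosedConvex C) (x : H) : proj C x ∈ C :=
  (hC.isNearest_proj x).1

theorem ClosedConvex.norm_sub_proj_le (hC : ClosedConvex C) (x : H) {c : H} (hc : c ∈ C) :
    ‖x - proj C x‖ ≤ ‖x - c‖ := by
  rw [norm_sub_rev x, norm_sub_rev x]
  exact (hC.isNearest_proj x).2 c hc

omit [CompleteSpace H] in
theorem isNearest_of_inner_nonpos {x p : H} (hp : p ∈ C)
    (h : ∀ c ∈ C, inner ℝ (x - p) (c - p) ≤ 0) : IsNearest C x p := by
  refine ⟨hp, fun c hc => ?_⟩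
  have := norm_sub_le_of_inner_nonpos (h c hc)
  rw [norm_sub_rev p, norm_sub_rev c]
  exact le_of_sq_le_sq (by nlinarith [sq_nonneg ‖p - c‖]) (norm_nonneg _)

theorem ClosedConvex.proj_eq_of_inner_nonpos (hC : ClosedConvex C) {x p : H} (hp : p ∈ C)
    (h : ∀ c ∈ C, inner ℝ (x - p) (c - p) ≤ 0) : proj C x = p :=
  (proj_eq_iff hC.nonempty hC.isClosed hC.convex x p).2 (isNearest_of_inner_nonpos hp h)

theorem ClosedConvex.proj_eq_self (hC : ClosedConvex C) {x : H} (hx : x ∈ C) : proj C x = x :=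
  hC.proj_eq_of_inner_nonpos hx (by simp)

theorem ClosedConvex.inner_sub_proj_nonpos (hC : ClosedConvex C) (x : H) {c : H} (hc : c ∈ C) :
    inner ℝ (x - proj C x) (c - proj C x) ≤ 0 := by
  have : Nonempty C := ⟨⟨c, hc⟩⟩
  refine (norm_eq_iInf_iff_real_inner_le_zero hC.convex (hC.proj_mem x)).1 ?_ c hc
  refine le_antisymm (le_ciInf fun w => hC.norm_sub_proj_le x w.2) ?_
  exact ciInf_le (f := fun w : C => ‖x - w‖)
    ⟨0, by rintro _ ⟨w, rfl⟩; exact norm_nonneg _⟩ ⟨_, hC.proj_mem x⟩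

theorem ClosedConvex.norm_sq_add_norm_sq_le (hC : ClosedConvex C) (x : H) {c : H} (hc : c ∈ C) :
    ‖x - proj C x‖ ^ 2 + ‖proj C x - c‖ ^ 2 ≤ ‖x - c‖ ^ 2 :=
  norm_sub_le_of_inner_nonpos (hC.inner_sub_proj_nonpos x hc)

/-- Firm nonexpansiveness of the projection, `h3`, is what makes `2 P_C - I` nonexpansive. -/
theorem ClosedConvex.norm_reflect_sub_le (hC : ClosedConvex C) (x y : H) :
    ‖reflect C x - reflect C y‖ ≤ ‖x - y‖ := by
  have h1 := hC.inner_sub_proj_nonpos x (hC.proj_mem y)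
  have h2 := hC.inner_sub_proj_nonpos y (hC.proj_mem x)
  have h3 : ‖proj C x - proj C y‖ ^ 2 ≤ inner ℝ (proj C x - proj C y) (x - y) := by
    rw [← real_inner_self_eq_norm_sq]
    simp only [inner_sub_left, inner_sub_right] at *
    linarith [real_inner_comm x (proj C x), real_inner_comm x (proj C y),
      real_inner_comm y (proj C x), real_inner_comm y (proj C y)]
  have e : reflect C x - reflect C y = (2 : ℝ) • (proj C x - proj C y) - (x - y) := by
    simp only [reflect, smul_sub]; abel
  refine le_of_sq_le_sq ?_ (norm_nonneg _)
  rw [e, norm_sub_sq_real, norm_smul, real_inner_smul_left, mul_pow]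
  norm_num
  linarith

end Projection

/-! ### Algebraic identities for one Douglas–Rachford step -/

theorem drOp_eq (A B : Set H) (x : H) :
    drOp A B x = x + (proj B (reflect A x) - proj A x) := by
  have : x + reflect B (reflect A x) = (2 : ℝ) • (x + (proj B (reflect A x) - proj A x)) := by
    conv_lhs => rw [reflect]
    simp only [reflect, smul_add, smul_sub, two_smul]
    abel
  rw [drOp, this, smul_smul]
  norm_num

theorem drOp_sub_self (A B : Set H) (x : H) :
    drOp A B x - x = proj B (reflect A x) - proj A x := by
  rw [drOp_eq]; abel

theorem drOp_sub_proj_reflect (A B : Set H) (x : H) :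
    drOp A B x - proj B (reflect A x) = x - proj A x := by
  rw [drOp_eq]; abel

theorem proj_reflect_sub_proj_drOp (A B : Set H) (x : H) :
    proj B (reflect A x) - proj B (drOp A B x) =
      (drOp A B x - x) - (proj B (drOp A B x) - proj A x) := by
  rw [drOp_sub_self]; abel

/-- The second sequence is the first sequence of the problem with the sets exchanged. -/
theorem seq₂_eq_seq₁_swap (A B : Set H) (z : H) (n : ℕ) :
    seq₂ A B z n = seq₁ B A (drOp A B z) n := by
  induction n with
  | zero => rfl
  | succ n ih => rw [seq₁, ← ih]; rfl

theorem seq₁_succ (A B : Set H) (z : H) (n : ℕ) :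
    seq₁ A B z (n + 1) = drOp B A (seq₂ A B z n) := rfl

/-! ### Contraction estimates and telescoping -/

section Operators

variable [CompleteSpace H] {A B : Set H}

/-- The operator is the midpoint of the identity and a nonexpansive map, so the parallelogram law
applies. -/
theorem drOp_firmlyNonexpansive (hA : ClosedConvex A) (hB : ClosedConvex B) (x y : H) :
    ‖drOp A B x - drOp A B y‖ ^ 2 + ‖(drOp A B x - x) - (drOp A B y - y)‖ ^ 2 ≤ ‖x - y‖ ^ 2 := by
  have hu : ‖reflect B (reflect A x) - reflect B (reflect A y)‖ ≤ ‖x - y‖ :=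
    (hB.norm_reflect_sub_le _ _).trans (hA.norm_reflect_sub_le _ _)
  set u := reflect B (reflect A x) with hu_def
  set w := reflect B (reflect A y) with hw_def
  have e1 : drOp A B x - drOp A B y = (1 / 2 : ℝ) • ((x - y) + (u - w)) := by
    rw [drOp, drOp, ← hu_def, ← hw_def]; module
  have e2 : (drOp A B x - x) - (drOp A B y - y) = -((1 / 2 : ℝ) • ((x - y) - (u - w))) := by
    rw [drOp, drOp, ← hu_def, ← hw_def]; module
  rw [e1, e2, norm_neg, norm_smul, norm_smul, mul_pow, mul_pow, norm_add_sq_real,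
    norm_sub_sq_real (x - y) (u - w)]
  have := pow_le_pow_left₀ (norm_nonneg _) hu 2
  norm_num
  linarith

theorem norm_drOp_sub_le (hA : ClosedConvex A) (hB : ClosedConvex B) (x y : H) :
    ‖drOp A B x - drOp A B y‖ ≤ ‖x - y‖ :=
  le_of_sq_le_sq (by
    have := drOp_firmlyNonexpansive hA hB x y
    nlinarith [sq_nonneg ‖(drOp A B x - x) - (drOp A B y - y)‖]) (norm_nonneg _)

theorem norm_cyclicOp_sub_le (hA : ClosedConvex A) (hB : ClosedConvex B) (x y : H) :
    ‖cyclicOp A B x - cyclicOp A B y‖ ≤ ‖x - y‖ :=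
  (norm_drOp_sub_le hB hA _ _).trans (norm_drOp_sub_le hA hB _ _)

/-- The cyclic operator is averaged. -/
theorem cyclicOp_averaged (hA : ClosedConvex A) (hB : ClosedConvex B) (x y : H) :
    ‖cyclicOp A B x - cyclicOp A B y‖ ^ 2 +
      (1 / 2) * ‖(cyclicOp A B x - x) - (cyclicOp A B y - y)‖ ^ 2 ≤ ‖x - y‖ ^ 2 := by
  have h1 := drOp_firmlyNonexpansive hA hB x y
  have h2 := drOp_firmlyNonexpansive hB hA (drOp A B x) (drOp A B y)
  simp only [cyclicOp, Function.comp_apply]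
  set a := (drOp A B x - x) - (drOp A B y - y)
  set b := (drOp B A (drOp A B x) - drOp A B x) - (drOp B A (drOp A B y) - drOp A B y)
  have e : (drOp B A (drOp A B x) - x) - (drOp B A (drOp A B y) - y) = a + b := by
    simp only [a, b]; abel
  -- The factor `1 / 2` comes from `‖a + b‖ ^ 2 ≤ 2 * (‖a‖ ^ 2 + ‖b‖ ^ 2)`.
  have h3 := parallelogram_law_with_norm ℝ a b
  rw [e]
  nlinarith [sq_nonneg ‖a - b‖]

/-- The distance of the current iterate to its set decreases, with a quantitative gain. -/
theorem norm_drOp_sub_proj_sq_le (A : Set H) (hB : ClosedConvex B) (x : H) :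
    ‖drOp A B x - proj B (drOp A B x)‖ ^ 2 +
      ‖proj B (reflect A x) - proj B (drOp A B x)‖ ^ 2 ≤ ‖x - proj A x‖ ^ 2 := by
  have := hB.norm_sq_add_norm_sq_le (drOp A B x) (hB.proj_mem (reflect A x))
  rwa [drOp_sub_proj_reflect, norm_sub_rev (proj B (drOp A B x))] at this

end Operators

omit [InnerProductSpace ℝ H] in
/-- If the nonnegative sequence `a` decreases by at least `‖u n‖ ^ 2`, up to a positive factor,
then `u` tends to zero. -/
theorem tendsto_zero_of_norm_sq_le {a : ℕ → ℝ} {u : ℕ → H} {k : ℝ} (hk : 0 < k)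
    (ha : ∀ n, 0 ≤ a n) (h : ∀ n, a (n + 1) + k * ‖u n‖ ^ 2 ≤ a n) :
    Tendsto u atTop (𝓝 0) := by
  have hanti : Antitone a := antitone_nat_of_succ_le fun n => by
    have := h n
    have : 0 ≤ k * ‖u n‖ ^ 2 := by positivity
    linarith
  have hlim := tendsto_atTop_ciInf hanti ⟨0, by rintro _ ⟨n, rfl⟩; exact ha n⟩
  have hdiff := (hlim.sub (hlim.comp (tendsto_add_atTop_nat 1))).div_const k
  rw [sub_self, zero_div] at hdiff
  have hsq : Tendsto (fun n => ‖u n‖ ^ 2) atTop (𝓝 0) :=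
    squeeze_zero (fun n => by positivity)
      (fun n => by
        simp only [Function.comp_apply]
        rw [le_div_iff₀ hk]
        linarith [h n]) hdiff
  rw [tendsto_zero_iff_norm_tendsto_zero]
  have := hsq.sqrt
  simpa [Real.sqrt_sq] using this

/-! ### Asymptotic regularity -/

section Regularity

variable [CompleteSpace H] {A B : Set H}

theorem tendsto_proj_reflect_sub_proj (hA : ClosedConvex A) (hB : ClosedConvex B) (z : H) :
    Tendsto (fun n => proj B (reflect A (seq₁ A B z n)) - proj B (seq₂ A B z n)) atTop (𝓝 0) := by
  refine tendsto_zero_of_norm_sq_le (k := 1) one_pos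
    (a := fun n => ‖seq₁ A B z n - proj A (seq₁ A B z n)‖ ^ 2) (fun n => by positivity) fun n => ?_
  have h1 := norm_drOp_sub_proj_sq_le A hB (seq₁ A B z n)
  have h2 := norm_drOp_sub_proj_sq_le B hA (seq₂ A B z n)
  rw [← seq₁_succ] at h2
  change ‖seq₂ A B z n - proj B (seq₂ A B z n)‖ ^ 2 +
    ‖proj B (reflect A (seq₁ A B z n)) - proj B (seq₂ A B z n)‖ ^ 2 ≤ _ at h1
  nlinarith [sq_nonneg ‖proj A (reflect B (seq₂ A B z n)) - proj A (seq₁ A B z (n + 1))‖]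

/-- On `A` the cyclic operator is `P_A P_B`. If `e ∈ A` minimizes the squared distance to `B` up to
`ε ^ 2`, then alternating projections can lower it by less than `ε ^ 2`, and this drop bounds the
squared step. -/
theorem exists_norm_cyclicOp_sub_lt (hA : ClosedConvex A) (hB : ClosedConvex B) {ε : ℝ}
    (hε : 0 < ε) : ∃ e, ‖cyclicOp A B e - e‖ < ε := by
  let g : H → ℝ := fun e => ‖e - proj B e‖ ^ 2
  have hbdd : BddBelow (g '' A) := ⟨0, by rintro _ ⟨w, -, rfl⟩; exact sq_nonneg _⟩
  obtain ⟨_, ⟨e, he, rfl⟩, hlt⟩ :=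
    exists_lt_of_csInf_lt (hA.nonempty.image g) (lt_add_of_pos_right (sInf (g '' A)) (pow_pos hε 2))
  refine ⟨e, ?_⟩
  have h1 : drOp A B e = proj B e := by
    rw [drOp_eq, reflect, hA.proj_eq_self he, two_smul]; simp
  have h2 : drOp B A (proj B e) = proj A (proj B e) := by
    rw [drOp_eq, reflect, hB.proj_eq_self (hB.proj_mem e), two_smul]; simp
  rw [cyclicOp, Function.comp_apply, h1, h2]
  have h3 := hA.norm_sq_add_norm_sq_le (proj B e) he
  have h4 := csInf_le hbdd ⟨_, hA.proj_mem (proj B e), rfl⟩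
  have h5 : g (proj A (proj B e)) ≤ ‖proj B e - proj A (proj B e)‖ ^ 2 := by
    rw [norm_sub_rev (proj B e)]
    exact pow_le_pow_left₀ (norm_nonneg _) (hB.norm_sub_proj_le _ (hB.proj_mem e)) 2
  rw [norm_sub_rev (proj B e) e] at h3
  exact lt_of_pow_lt_pow_left₀ 2 hε.le (by simp only [g] at *; linarith)

/-- The cyclic operator is asymptotically regular, even without fixed points. -/
theorem tendsto_seq₁_succ_sub (hA : ClosedConvex A) (hB : ClosedConvex B) (z : H) :
    Tendsto (fun n => cyclicOp A B (seq₁ A B z n) - seq₁ A B z n) atTop (𝓝 0) := by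
  rw [Metric.tendsto_atTop]
  intro ε hε
  obtain ⟨e, he⟩ := exists_norm_cyclicOp_sub_lt hA hB (half_pos hε)
  have hstep : ∀ n, ‖cyclicOp A B (seq₁ A B e n) - seq₁ A B e n‖ < ε / 2 := by
    intro n
    induction n with
    | zero => exact he
    | succ n ih => exact (norm_cyclicOp_sub_le hA hB _ _).trans_lt ih
  -- Averagedness makes the steps of the two orbits asymptotically equal; those of the orbit of `e`
  -- stay below `ε / 2`.
  have hlim := tendsto_zero_of_norm_sq_le (k := 1 / 2) (by norm_num)
    (a := fun n => ‖seq₁ A B z n - seq₁ A B e n‖ ^ 2) (fun n => by positivity)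
    (fun n => cyclicOp_averaged hA hB (seq₁ A B z n) (seq₁ A B e n))
  obtain ⟨N, hN⟩ := Metric.tendsto_atTop.1 hlim (ε / 2) (half_pos hε)
  refine ⟨N, fun n hn => ?_⟩
  have h1 := hN n hn
  rw [dist_zero_right] at h1 ⊢
  have h2 := norm_le_norm_sub_add (cyclicOp A B (seq₁ A B z n) - seq₁ A B z n)
    (cyclicOp A B (seq₁ A B e n) - seq₁ A B e n)
  linarith [hstep n]

end Regularity

/-! ### Weak limits, demiclosedness and Opial's argument -/

section WeakLimits

variable [CompleteSpace H]

/-- A family bounded along an ultrafilter converges weakly along it. -/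
theorem exists_weak_limit_ultrafilter {ι : Type*} (U : Ultrafilter ι) (x : ι → H) {M : ℝ}
    (hM : ∀ᶠ n in U, ‖x n‖ ≤ M) :
    ∃ l : H, ∀ h : H, Tendsto (fun n => inner ℝ (x n) h) U (𝓝 (inner ℝ l h)) := by
  let φ : H → WeakDual ℝ H := fun y => StrongDual.toWeakDual (InnerProductSpace.toDual ℝ H y)
  -- Banach–Alaoglu, transported to `H` by the Riesz isometry.
  have hK := WeakDual.isCompact_closedBall (𝕜 := ℝ) (0 : StrongDual ℝ H) M
  obtain ⟨f, -, hf⟩ := hK.ultrafilter_le_nhds (U.map fun n => φ (x n)) (by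
    rw [le_principal_iff]
    refine Ultrafilter.mem_map.2 (mem_of_superset hM fun n hn => ?_)
    simpa [φ] using hn)
  refine ⟨(InnerProductSpace.toDual ℝ H).symm (WeakDual.toStrongDual f), fun h => ?_⟩
  have h1 : Tendsto (fun n => φ (x n)) U (𝓝 f) := hf
  have h2 := ((WeakDual.eval_continuous h).tendsto f).comp h1
  have h3 : inner ℝ ((InnerProductSpace.toDual ℝ H).symm (WeakDual.toStrongDual f)) h = f h := by
    rw [InnerProductSpace.toDual_symm_apply]; rfl
  rw [h3]
  exact h2

omit [CompleteSpace H] in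
/-- Demiclosedness principle for nonexpansive maps. -/
theorem eq_of_weak_limit_of_asymptotically_fixed {ι : Type*} {U : Filter ι} [U.NeBot] {x : ι → H}
    {N : H → H} (hN : ∀ a b, ‖N a - N b‖ ≤ ‖a - b‖) {M : ℝ} (hM : ∀ᶠ n in U, ‖x n‖ ≤ M)
    (hreg : Tendsto (fun n => N (x n) - x n) U (𝓝 0)) {l : H}
    (hl : ∀ h : H, Tendsto (fun n => inner ℝ (x n) h) U (𝓝 (inner ℝ l h))) : N l = l := by
  have hr : Tendsto (fun n => ‖N (x n) - x n‖) U (𝓝 0) := by simpa using hreg.norm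
  have hr1 : Tendsto (fun n => ‖N (x n) - x n‖ ^ 2 + 2 * (M + ‖l‖) * ‖N (x n) - x n‖) U (𝓝 0) := by
    simpa using (hr.pow 2).add (hr.const_mul (2 * (M + ‖l‖)))
  have hin : Tendsto (fun n => 2 * (inner ℝ (x n) (l - N l) - inner ℝ l (l - N l)) + ‖l - N l‖ ^ 2)
      U (𝓝 (‖l - N l‖ ^ 2)) := by
    simpa using (((hl (l - N l)).sub_const (inner ℝ l (l - N l))).const_mul 2).add_const
      (‖l - N l‖ ^ 2)
  -- Expand `‖x n - N l‖ ^ 2` about `l` and compare it with `(‖N (x n) - x n‖ + ‖x n - l‖) ^ 2`: the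
  -- terms `‖x n - l‖ ^ 2` cancel.
  have hle : ‖l - N l‖ ^ 2 ≤ 0 := by
    refine le_of_tendsto_of_tendsto hin hr1 ?_
    filter_upwards [hM] with n hn
    have h1 : ‖x n - N l‖ ≤ ‖N (x n) - x n‖ + ‖x n - l‖ := by
      have := norm_sub_le_norm_sub_add_norm_sub (x n) (N (x n)) (N l)
      rw [norm_sub_rev (x n) (N (x n))] at this
      linarith [hN (x n) l]
    have h2 : ‖x n - l‖ ≤ M + ‖l‖ := (norm_sub_le _ _).trans (by linarith)
    have h3 : ‖x n - N l‖ ^ 2 = ‖x n - l‖ ^ 2 + 2 * inner ℝ (x n - l) (l - N l) + ‖l - N l‖ ^ 2 := by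
      rw [← norm_add_sq_real]; congr 2; abel
    rw [inner_sub_left] at h3
    have h4 := pow_le_pow_left₀ (norm_nonneg _) h1 2
    nlinarith [mul_le_mul_of_nonneg_left h2 (norm_nonneg (N (x n) - x n))]
  have : ‖l - N l‖ = 0 := by nlinarith [norm_nonneg (l - N l)]
  exact (sub_eq_zero.1 (norm_eq_zero.1 this)).symm

theorem weakConv_iff_tendsto_inner {x : ℕ → H} {l : H} :
    WeakConv x l ↔ ∀ h : H, Tendsto (fun n => inner ℝ (x n) h) atTop (𝓝 (inner ℝ l h)) := by
  have h1 : WeakConv x l ↔ ∀ f : StrongDual ℝ H, Tendsto (fun n => f (x n)) atTop (𝓝 (f l)) := by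
    have hind : IsInducing fun (y : WeakSpace ℝ H) (f : StrongDual ℝ H) =>
        (topDualPairing ℝ H).flip y f := ⟨rfl⟩
    rw [WeakConv, hind.tendsto_nhds_iff]
    exact tendsto_pi_nhds
  rw [h1]
  constructor
  · intro h y
    simpa only [InnerProductSpace.toDual_apply_apply, real_inner_comm] using
      h (InnerProductSpace.toDual ℝ H y)
  · intro h f
    obtain ⟨y, rfl⟩ := (InnerProductSpace.toDual ℝ H).surjective f
    simpa only [InnerProductSpace.toDual_apply_apply, real_inner_comm] using h y

/-- Opial's lemma: a Fejér monotone asymptotically regular orbit of a nonexpansive map converges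
weakly to a fixed point. -/
theorem exists_weakConv_of_fejer {N : H → H} (hN : ∀ a b, ‖N a - N b‖ ≤ ‖a - b‖) {x : ℕ → H}
    (hx : ∀ n, x (n + 1) = N (x n)) (hreg : Tendsto (fun n => N (x n) - x n) atTop (𝓝 0))
    (hfix : (Function.fixedPoints N).Nonempty) :
    ∃ l ∈ Function.fixedPoints N, WeakConv x l := by
  have hanti : ∀ c ∈ Function.fixedPoints N, Antitone fun n => ‖x n - c‖ := fun c hc =>
    antitone_nat_of_succ_le fun n => by
      have := hN (x n) c
      rwa [← hx, hc.eq] at this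
  obtain ⟨c, hc⟩ := hfix
  have hM : ∀ n, ‖x n‖ ≤ ‖x 0 - c‖ + ‖c‖ := fun n => by
    have h1 := hanti c hc (Nat.zero_le n)
    have h2 := norm_le_norm_sub_add (x n) c
    simp only at h1
    linarith
  have hlim : ∀ U : Ultrafilter ℕ, (U : Filter ℕ) ≤ atTop → ∃ l ∈ Function.fixedPoints N,
      ∀ h : H, Tendsto (fun n => inner ℝ (x n) h) U (𝓝 (inner ℝ l h)) := fun U hU => by
    obtain ⟨l, hl⟩ := exists_weak_limit_ultrafilter U x (Eventually.of_forall hM)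
    exact ⟨l, eq_of_weak_limit_of_asymptotically_fixed hN (Eventually.of_forall hM)
      (hreg.mono_left hU) hl, hl⟩
  obtain ⟨l, hlfix, hl⟩ := hlim (Ultrafilter.of atTop) (Ultrafilter.of_le atTop)
  refine ⟨l, hlfix, weakConv_iff_tendsto_inner.2 fun h => ?_⟩
  rw [tendsto_iff_ultrafilter]
  intro U hU
  obtain ⟨m, hmfix, hm⟩ := hlim U hU
  suffices m = l by rw [← this]; exact hm h
  have hconv : ∀ c ∈ Function.fixedPoints N, ∃ r : ℝ, Tendsto (fun n => ‖x n - c‖) atTop (𝓝 r) :=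
    fun c hc => ⟨_, tendsto_atTop_ciInf (hanti c hc) ⟨0, by rintro _ ⟨n, rfl⟩; exact norm_nonneg _⟩⟩
  obtain ⟨r, hr⟩ := hconv l hlfix
  obtain ⟨s, hs⟩ := hconv m hmfix
  -- By polarization this inner product converges along the whole sequence, so the two ultrafilter
  -- limits `l` and `m` have the same inner product with `m - l`.
  have hin : Tendsto (fun n => inner ℝ (x n) (m - l)) atTop
      (𝓝 ((r ^ 2 - s ^ 2 - ‖l‖ ^ 2 + ‖m‖ ^ 2) / 2)) := by
    refine (((((hr.pow 2).sub (hs.pow 2)).sub_const (‖l‖ ^ 2)).add_const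
      (‖m‖ ^ 2)).div_const 2).congr fun n => ?_
    rw [norm_sub_sq_real, norm_sub_sq_real, inner_sub_right]
    ring
  have h1 := tendsto_nhds_unique (hl (m - l)) (hin.mono_left (Ultrafilter.of_le atTop))
  have h2 := tendsto_nhds_unique (hm (m - l)) (hin.mono_left hU)
  have h3 : inner ℝ (m - l) (m - l) = 0 := by
    rw [inner_sub_left, h1, h2, sub_self]
  exact sub_eq_zero.1 (inner_self_eq_zero.1 h3)

/-- An asymptotically regular sequence without fixed points in the limit leaves bounded sets. -/
theorem tendsto_norm_atTop_of_fixedPoints_eq_empty {N : H → H}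
    (hN : ∀ a b, ‖N a - N b‖ ≤ ‖a - b‖) {x : ℕ → H}
    (hreg : Tendsto (fun n => N (x n) - x n) atTop (𝓝 0))
    (hfix : Function.fixedPoints N = ∅) : Tendsto (fun n => ‖x n‖) atTop atTop := by
  rw [tendsto_iff_ultrafilter]
  intro U hU
  by_contra hcon
  rw [tendsto_atTop] at hcon
  push Not at hcon
  obtain ⟨M, hM⟩ := hcon
  have hM' : ∀ᶠ n in (U : Filter ℕ), ‖x n‖ ≤ M := hM.mono fun n hn => hn.le
  obtain ⟨l, hl⟩ := exists_weak_limit_ultrafilter U x hM'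
  have : l ∈ Function.fixedPoints N :=
    eq_of_weak_limit_of_asymptotically_fixed hN hM' (hreg.mono_left hU) hl
  simp [hfix] at this

end WeakLimits

/-! ### Best approximation pairs and fixed points -/

section BestApproximation

omit [InnerProductSpace ℝ H] in
theorem IsBestApproxPair.symm {A B : Set H} {p q : H} (h : IsBestApproxPair A B p q) :
    IsBestApproxPair B A q p :=
  ⟨h.2.1, h.1, fun b hb a ha => by
    rw [norm_sub_rev q, norm_sub_rev b]; exact h.2.2 a ha b hb⟩

omit [InnerProductSpace ℝ H] in
theorem bddBelow_range_norm_sub (A B : Set H) :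
    BddBelow (Set.range fun p : A × B => ‖(p.1 : H) - (p.2 : H)‖) :=
  ⟨0, by rintro _ ⟨p, rfl⟩; exact norm_nonneg _⟩

omit [InnerProductSpace ℝ H] in
theorem IsBestApproxPair.mem_nearestSet {A B : Set H} {p q : H} (h : IsBestApproxPair A B p q) :
    p ∈ nearestSet A B := by
  have : Nonempty (A × B) := ⟨⟨⟨p, h.1⟩, ⟨q, h.2.1⟩⟩⟩
  have h1 : setDist A B = ‖p - q‖ :=
    le_antisymm (ciInf_le (bddBelow_range_norm_sub A B) ⟨⟨p, h.1⟩, ⟨q, h.2.1⟩⟩)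
      (le_ciInf fun w => h.2.2 _ w.1.2 _ w.2.2)
  refine ⟨h.1, le_antisymm ?_ ?_⟩
  · rw [h1, ← dist_eq_norm]
    exact Metric.infDist_le_dist_of_mem h.2.1
  · rw [h1]
    refine (Metric.le_infDist ⟨q, h.2.1⟩).2 fun b hb => ?_
    rw [dist_eq_norm]
    exact h.2.2 p h.1 b hb

variable [CompleteSpace H] {A B : Set H}

theorem exists_isBestApproxPair_of_mem_nearestSet (hB : ClosedConvex B) {e : H}
    (he : e ∈ nearestSet A B) : IsBestApproxPair A B e (proj B e) := by
  refine ⟨he.1, hB.proj_mem e, fun a ha b hb => ?_⟩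
  calc ‖e - proj B e‖ ≤ Metric.infDist e B :=
        (Metric.le_infDist hB.nonempty).2 fun c hc => by
          rw [dist_eq_norm]; exact hB.norm_sub_proj_le e hc
    _ = setDist A B := he.2
    _ ≤ ‖a - b‖ := ciInf_le (bddBelow_range_norm_sub A B) ⟨⟨a, ha⟩, ⟨b, hb⟩⟩

theorem IsBestApproxPair.proj_right (hB : ClosedConvex B) {p q : H}
    (h : IsBestApproxPair A B p q) : proj B p = q :=
  (proj_eq_iff hB.nonempty hB.isClosed hB.convex p q).2 ⟨h.2.1, fun b hb => by
    rw [norm_sub_rev q, norm_sub_rev b]; exact h.2.2 p h.1 b hb⟩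

theorem IsBestApproxPair.drOp_eq (hA : ClosedConvex A) (hB : ClosedConvex B) {p q : H}
    (h : IsBestApproxPair A B p q) : drOp A B p = q := by
  rw [DouglasRachford.drOp_eq, reflect, hA.proj_eq_self h.1, two_smul, add_sub_cancel_right,
    h.proj_right hB, add_sub_cancel]

theorem IsBestApproxPair.mem_fixedPoints (hA : ClosedConvex A) (hB : ClosedConvex B) {p q : H}
    (h : IsBestApproxPair A B p q) : p ∈ Function.fixedPoints (cyclicOp A B) := by
  change drOp B A (drOp A B p) = p
  rw [h.drOp_eq hA hB, h.symm.drOp_eq hB hA]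

theorem IsBestApproxPair.sub_eq_displacement (hA : ClosedConvex A) (hB : ClosedConvex B) {p q : H}
    (h : IsBestApproxPair A B p q) : q - p = displacement A B := by
  have hmem := Set.sub_mem_sub h.2.1 h.1
  refine ((proj_eq_iff (C := closure (B - A)) ⟨_, subset_closure hmem⟩ isClosed_closure
    (hB.convex.sub hA.convex).closure 0 _).2 ⟨subset_closure hmem, fun c hc => ?_⟩).symm
  rw [sub_zero, sub_zero]
  -- Minimality of the norm over `B - A` is a closed condition, hence passes to the closure.
  refine closure_minimal (t := {c | ‖q - p‖ ≤ ‖c‖}) ?_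
    (isClosed_le continuous_const continuous_norm) hc
  rintro _ ⟨b, hb, a, ha, rfl⟩
  exact h.symm.2.2 b hb a ha

omit [CompleteSpace H] in
-- Adding the two normal-cone inequalities gives `‖p - q‖ ^ 2 ≤ ⟪p - q, a - b⟫`; Cauchy–Schwarz
-- concludes.
theorem isBestApproxPair_of_inner_nonpos {p q : H} (hp : p ∈ A) (hq : q ∈ B)
    (h1 : ∀ a ∈ A, inner ℝ (q - p) (a - p) ≤ 0) (h2 : ∀ b ∈ B, inner ℝ (p - q) (b - q) ≤ 0) :
    IsBestApproxPair A B p q := by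
  refine ⟨hp, hq, fun a ha b hb => ?_⟩
  have h3 : ‖p - q‖ ^ 2 ≤ inner ℝ (p - q) (a - b) := by
    have e : inner ℝ (p - q) (a - b) =
        inner ℝ (p - q) (p - q) - inner ℝ (q - p) (a - p) - inner ℝ (p - q) (b - q) := by
      simp only [inner_sub_left, inner_sub_right]; ring
    rw [e, real_inner_self_eq_norm_sq]
    linarith [h1 a ha, h2 b hb]
  have h4 := h3.trans (real_inner_le_norm _ _)
  rcases (norm_nonneg (p - q)).eq_or_lt with h0 | h0
  · rw [← h0]; exact norm_nonneg _
  · rw [sq] at h4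
    exact le_of_mul_le_mul_left h4 h0

/-- Around a cycle the distance returns to its initial value, so the gains of both half-steps
vanish. -/
theorem fixedPoint_proj_reflect (hA : ClosedConvex A) (hB : ClosedConvex B) {x : H}
    (hx : drOp B A (drOp A B x) = x) :
    proj B (reflect A x) = proj B (drOp A B x) ∧ proj A (reflect B (drOp A B x)) = proj A x := by
  have h1 := norm_drOp_sub_proj_sq_le A hB x
  have h2 := norm_drOp_sub_proj_sq_le B hA (drOp A B x)
  rw [hx] at h2
  constructor <;> refine sub_eq_zero.1 (norm_eq_zero.1 (pow_eq_zero_iff two_ne_zero |>.1 ?_))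
  · nlinarith [sq_nonneg ‖proj B (reflect A x) - proj B (drOp A B x)‖,
      sq_nonneg ‖proj A (reflect B (drOp A B x)) - proj A x‖]
  · nlinarith [sq_nonneg ‖proj B (reflect A x) - proj B (drOp A B x)‖,
      sq_nonneg ‖proj A (reflect B (drOp A B x)) - proj A x‖]

/-- The shadows of a fixed point of the cyclic operator form a best approximation pair. -/
theorem isBestApproxPair_of_fixedPoint (hA : ClosedConvex A) (hB : ClosedConvex B) {x : H}
    (hx : drOp B A (drOp A B x) = x) :
    IsBestApproxPair A B (proj A x) (proj B (drOp A B x)) := by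
  obtain ⟨hq, hp⟩ := fixedPoint_proj_reflect hA hB hx
  have hw := drOp_sub_proj_reflect A B x
  rw [hq] at hw
  refine isBestApproxPair_of_inner_nonpos (hA.proj_mem _) (hB.proj_mem _)
    (fun a ha => ?_) fun b hb => ?_
  · have h1 := hA.inner_sub_proj_nonpos x ha
    have h2 := hA.inner_sub_proj_nonpos (reflect B (drOp A B x)) ha
    rw [hp] at h2
    -- Since `x - P_A x = T x - P_B (T x)`, the gap is a sum of two vectors normal to `A` at `proj A
    -- x`.
    have e : proj B (drOp A B x) - proj A x =
        (x - proj A x) + (reflect B (drOp A B x) - proj A x) := by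
      rw [← hw, reflect, two_smul]; abel
    rw [e, inner_add_left]
    linarith
  · have h1 := hB.inner_sub_proj_nonpos (drOp A B x) hb
    have h2 := hB.inner_sub_proj_nonpos (reflect A x) hb
    rw [hq] at h2
    have e : proj A x - proj B (drOp A B x) =
        (drOp A B x - proj B (drOp A B x)) + (reflect A x - proj B (drOp A B x)) := by
      rw [hw, reflect, two_smul]; abel
    rw [e, inner_add_left]
    linarith

theorem nearestSet_nonempty_iff (hB : ClosedConvex B) :
    (nearestSet A B).Nonempty ↔ ∃ p q, IsBestApproxPair A B p q :=
  ⟨fun ⟨e, he⟩ => ⟨e, _, exists_isBestApproxPair_of_mem_nearestSet hB he⟩,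
    fun ⟨p, _, h⟩ => ⟨p, h.mem_nearestSet⟩⟩

theorem fixedPoints_cyclicOp_nonempty_iff (hA : ClosedConvex A) (hB : ClosedConvex B) :
    (Function.fixedPoints (cyclicOp A B)).Nonempty ↔ ∃ p q, IsBestApproxPair A B p q :=
  ⟨fun ⟨_, hx⟩ => ⟨_, _, isBestApproxPair_of_fixedPoint hA hB hx⟩,
    fun ⟨p, _, h⟩ => ⟨p, h.mem_fixedPoints hA hB⟩⟩

omit [InnerProductSpace ℝ H] [CompleteSpace H] in
theorem exists_isBestApproxPair_swap :
    (∃ p q, IsBestApproxPair A B p q) ↔ ∃ p q, IsBestApproxPair B A p q :=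
  ⟨fun ⟨p, q, h⟩ => ⟨q, p, h.symm⟩, fun ⟨p, q, h⟩ => ⟨q, p, h.symm⟩⟩

/-- The pair is a 2-cycle `p ↦ q ↦ p`; the squared distance to `p` telescopes, its drop controlling
the deviation of the half-step from `q - p`. -/
theorem IsBestApproxPair.tendsto_seq₂_sub_seq₁ (hA : ClosedConvex A) (hB : ClosedConvex B) {p q : H}
    (h : IsBestApproxPair A B p q) (z : H) :
    Tendsto (fun n => seq₂ A B z n - seq₁ A B z n) atTop (𝓝 (q - p)) := by
  rw [← tendsto_sub_nhds_zero_iff]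
  refine tendsto_zero_of_norm_sq_le (k := 1) one_pos
    (a := fun n => ‖seq₁ A B z n - p‖ ^ 2) (fun n => by positivity) fun n => ?_
  have h1 := drOp_firmlyNonexpansive hA hB (seq₁ A B z n) p
  have h2 := norm_drOp_sub_le hB hA (seq₂ A B z n) q
  rw [h.drOp_eq hA hB] at h1
  rw [h.symm.drOp_eq hB hA, ← seq₁_succ] at h2
  have h3 := pow_le_pow_left₀ (norm_nonneg _) h2 2
  rw [one_mul]
  exact (add_le_add_left h3 _).trans h1

end BestApproximation

end DouglasRachford

/-! ### Assembly of the main theorem -/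

theorem theorem3p2 {H : Type*} [NormedAddCommGroup H] [InnerProductSpace ℝ H] [CompleteSpace H]
    (C₁ C₂ : Set H)
    (hne₁ : C₁.Nonempty) (hcl₁ : IsClosed C₁) (hconv₁ : Convex ℝ C₁)
    (hne₂ : C₂.Nonempty) (hcl₂ : IsClosed C₂) (hconv₂ : Convex ℝ C₂)
    (z : H) (x₁ x₂ : ℕ → H) (hx₁ : x₁ = seq₁ C₁ C₂ z) (hx₂ : x₂ = seq₂ C₁ C₂ z)
    (E F : Set H) (hE : E = nearestSet C₁ C₂) (hF : F = nearestSet C₂ C₁)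
    (v : H) (hv : v = displacement C₁ C₂) :
    -- part (a)
    ((∀ n, proj C₂ (reflect C₁ (x₁ n)) - proj C₂ (x₂ n)
        = (x₂ n - x₁ n) - (proj C₂ (x₂ n) - proj C₁ (x₁ n))) ∧
      Tendsto (fun n => proj C₂ (reflect C₁ (x₁ n)) - proj C₂ (x₂ n)) atTop (𝓝 0) ∧
      (∀ n, proj C₁ (reflect C₂ (x₂ n)) - proj C₁ (x₁ (n + 1))
        = (x₁ (n + 1) - x₂ n) - (proj C₁ (x₁ (n + 1)) - proj C₂ (x₂ n))) ∧
      Tendsto (fun n => proj C₁ (reflect C₂ (x₂ n)) - proj C₁ (x₁ (n + 1))) atTop (𝓝 0)) ∧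
    -- part (b): exactly one of the two alternatives holds
    Xor
      (E = ∅ ∧ F = ∅ ∧ Function.fixedPoints (cyclicOp C₁ C₂) = ∅ ∧
        Function.fixedPoints (cyclicOp C₂ C₁) = ∅)
      (E.Nonempty ∧ F.Nonempty ∧ (Function.fixedPoints (cyclicOp C₁ C₂)).Nonempty ∧
        (Function.fixedPoints (cyclicOp C₂ C₁)).Nonempty) ∧
    -- consequences of alternative (i)
    ((E = ∅ ∧ F = ∅ ∧ Function.fixedPoints (cyclicOp C₁ C₂) = ∅ ∧
        Function.fixedPoints (cyclicOp C₂ C₁) = ∅) →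
      Tendsto (fun n => ‖x₁ n‖) atTop atTop ∧ Tendsto (fun n => ‖x₂ n‖) atTop atTop) ∧
    -- consequences of alternative (ii)
    ((E.Nonempty ∧ F.Nonempty ∧ (Function.fixedPoints (cyclicOp C₁ C₂)).Nonempty ∧
        (Function.fixedPoints (cyclicOp C₂ C₁)).Nonempty) →
      ((∀ n, x₂ n - x₁ n = proj C₂ (reflect C₁ (x₁ n)) - proj C₁ (x₁ n)) ∧
        Tendsto (fun n => x₂ n - x₁ n) atTop (𝓝 v) ∧
        Tendsto (fun n => proj C₂ (x₂ n) - proj C₁ (x₁ n)) atTop (𝓝 v) ∧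
        (∀ n, x₁ (n + 1) - x₂ n = proj C₁ (reflect C₂ (x₂ n)) - proj C₂ (x₂ n)) ∧
        Tendsto (fun n => x₁ (n + 1) - x₂ n) atTop (𝓝 (-v)) ∧
        Tendsto (fun n => proj C₁ (x₁ (n + 1)) - proj C₂ (x₂ n)) atTop (𝓝 (-v))) ∧
      ∃ y₁ ∈ Function.fixedPoints (cyclicOp C₁ C₂), ∃ y₂ ∈ Function.fixedPoints (cyclicOp C₂ C₁),
        WeakConv x₁ y₁ ∧ WeakConv x₂ y₂ ∧
        y₂ = drOp C₁ C₂ y₁ ∧ y₁ = drOp C₂ C₁ y₂ ∧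
        y₂ - y₁ = proj C₂ y₂ - proj C₁ y₁ ∧ proj C₂ y₂ - proj C₁ y₁ = v ∧
        proj C₁ (reflect C₂ y₂) = proj C₁ y₁ ∧ proj C₁ y₁ ∈ E ∧
        proj C₂ (reflect C₁ y₁) = proj C₂ y₂ ∧ proj C₂ y₂ ∈ F ∧
        IsBestApproxPair C₁ C₂ (proj C₁ y₁) (proj C₂ y₂)) := by
  have hA : ClosedConvex C₁ := ⟨hne₁, hcl₁, hconv₁⟩
  have hB : ClosedConvex C₂ := ⟨hne₂, hcl₂, hconv₂⟩
  subst hE hF hv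
  -- With the sets exchanged and the start at `drOp C₁ C₂ z`, `x₂` becomes the first sequence and
  -- the shifted `x₁` the second, so each result also serves the other half-step.
  have hx₁' : ∀ n, x₁ (n + 1) = seq₂ C₂ C₁ (drOp C₁ C₂ z) n := fun n => by
    rw [hx₁, seq₁_succ, seq₂_eq_seq₁_swap]; rfl
  have hx₂' : x₂ = seq₁ C₂ C₁ (drOp C₁ C₂ z) := by
    rw [hx₂]; exact funext (seq₂_eq_seq₁_swap C₁ C₂ z)
  have hx₂n : ∀ n, x₂ n = drOp C₁ C₂ (x₁ n) := fun n => by rw [hx₁, hx₂]; rfl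
  have hx₁n : ∀ n, x₁ (n + 1) = drOp C₂ C₁ (x₂ n) := fun n => by rw [hx₁, hx₂]; rfl
  have hreg₁ : Tendsto (fun n => cyclicOp C₁ C₂ (x₁ n) - x₁ n) atTop (𝓝 0) :=
    hx₁ ▸ tendsto_seq₁_succ_sub hA hB z
  have hreg₂ : Tendsto (fun n => cyclicOp C₂ C₁ (x₂ n) - x₂ n) atTop (𝓝 0) :=
    hx₂' ▸ tendsto_seq₁_succ_sub hB hA _
  have ha₁ : Tendsto (fun n => proj C₂ (reflect C₁ (x₁ n)) - proj C₂ (x₂ n)) atTop (𝓝 0) := by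
    rw [hx₁, hx₂]; exact tendsto_proj_reflect_sub_proj hA hB z
  have ha₂ : Tendsto (fun n => proj C₁ (reflect C₂ (x₂ n)) - proj C₁ (x₁ (n + 1))) atTop
      (𝓝 0) := by
    simp only [hx₁', hx₂']; exact tendsto_proj_reflect_sub_proj hB hA _
  have heq₁ : ∀ n, proj C₂ (reflect C₁ (x₁ n)) - proj C₂ (x₂ n)
      = (x₂ n - x₁ n) - (proj C₂ (x₂ n) - proj C₁ (x₁ n)) := fun n => by
    rw [hx₂n]; exact proj_reflect_sub_proj_drOp C₁ C₂ _
  have heq₂ : ∀ n, proj C₁ (reflect C₂ (x₂ n)) - proj C₁ (x₁ (n + 1))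
      = (x₁ (n + 1) - x₂ n) - (proj C₁ (x₁ (n + 1)) - proj C₂ (x₂ n)) := fun n => by
    rw [hx₁n]; exact proj_reflect_sub_proj_drOp C₂ C₁ _
  refine ⟨⟨heq₁, ha₁, heq₂, ha₂⟩, ?_, ?_, ?_⟩
  · have e1 := nearestSet_nonempty_iff (A := C₁) hB
    have e2 := (nearestSet_nonempty_iff (A := C₂) hA).trans exists_isBestApproxPair_swap
    have e3 := fixedPoints_cyclicOp_nonempty_iff hA hB
    have e4 := (fixedPoints_cyclicOp_nonempty_iff hB hA).trans exists_isBestApproxPair_swap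
    simp only [← Set.not_nonempty_iff_eq_empty, e1, e2, e3, e4]
    by_cases h : ∃ p q, IsBestApproxPair C₁ C₂ p q <;> simp [h, Xor]
  · rintro ⟨-, -, h1, h2⟩
    exact ⟨tendsto_norm_atTop_of_fixedPoints_eq_empty (norm_cyclicOp_sub_le hA hB) hreg₁ h1,
      tendsto_norm_atTop_of_fixedPoints_eq_empty (norm_cyclicOp_sub_le hB hA) hreg₂ h2⟩
  · rintro ⟨-, -, hfix, -⟩
    obtain ⟨p, q, hpq⟩ := (fixedPoints_cyclicOp_nonempty_iff hA hB).1 hfix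
    have hv₁ : Tendsto (fun n => x₂ n - x₁ n) atTop (𝓝 (displacement C₁ C₂)) := by
      rw [← hpq.sub_eq_displacement hA hB, hx₁, hx₂]
      exact hpq.tendsto_seq₂_sub_seq₁ hA hB z
    have hv₂ : Tendsto (fun n => x₁ (n + 1) - x₂ n) atTop (𝓝 (-displacement C₁ C₂)) := by
      rw [← hpq.sub_eq_displacement hA hB, neg_sub]
      simp only [hx₁', hx₂']
      exact hpq.symm.tendsto_seq₂_sub_seq₁ hB hA _
    refine ⟨⟨fun n => by rw [hx₂n]; exact drOp_sub_self C₁ C₂ _, hv₁, ?_,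
      fun n => by rw [hx₁n]; exact drOp_sub_self C₂ C₁ _, hv₂, ?_⟩, ?_⟩
    · have := hv₁.sub ha₁
      rw [sub_zero] at this
      exact this.congr fun n => by rw [heq₁, sub_sub_cancel]
    · have := hv₂.sub ha₂
      rw [sub_zero] at this
      exact this.congr fun n => by rw [heq₂, sub_sub_cancel]
    · obtain ⟨y, hy, hyw⟩ := exists_weakConv_of_fejer (norm_cyclicOp_sub_le hA hB)
        (fun n => by rw [hx₁]; rfl) hreg₁ hfix
      have hy' : drOp C₂ C₁ (drOp C₁ C₂ y) = y := hy
      have hbest := isBestApproxPair_of_fixedPoint hA hB hy'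
      obtain ⟨hq, hp⟩ := fixedPoint_proj_reflect hA hB hy'
      have hdiff : drOp C₁ C₂ y - y = proj C₂ (drOp C₁ C₂ y) - proj C₁ y := by
        rw [drOp_sub_self, hq]
      have hdisp := hbest.sub_eq_displacement hA hB
      refine ⟨y, hy, drOp C₁ C₂ y, congrArg (drOp C₁ C₂) hy', hyw, ?_, rfl, hy'.symm, hdiff, hdisp,
        hp, hbest.mem_nearestSet, hq, hbest.symm.mem_nearestSet, hbest⟩
      rw [weakConv_iff_tendsto_inner] at hyw ⊢
      intro h
      -- `drOp` need not be weakly continuous; the weak limit of `x₂` is that of `x₁` plus the norm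
      -- limit of `x₂ n - x₁ n`.
      have := (hyw h).add (hv₁.inner (tendsto_const_nhds (x := h)))
      rw [← inner_add_left, ← hdisp, ← hdiff, add_sub_cancel] at this
      exact this.congr fun n => by rw [← inner_add_left, add_sub_cancel]
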